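/- Let $\mathfrak h_3$ be the real Heisenberg Lie algebra, with basis $x_1,x_2,x_3$ and only nonzero bracket $[x_1,x_2]=x_3$, and let $T^*\mathfrak h_3=\mathfrak h_3\ltimes_{\mathrm{ad}^*}\mathfrak h_3^*$ be its cotangent Lie algebra, with bracket $[(x,\phi),(y,\psi)]=([x,y],\mathrm{ad}^*(x)\psi-\mathrm{ad}^*(y)\phi)$, where $(\mathrm{ad}^*(x)\psi)(z)=-\psi([x,z])$. Let $x^1,x^2,x^3$ be the dual basis of $\mathfrak h_3^*$ and put $(e_1,\dots,e_6)=(x_1,x_2,x^3,x^1,x^2,x_3)$, so that the nonzero brackets are $[e_1,e_2]=e_6$, $[e_1,e_3]=-e_5$, $[e_2,e_3]=e_4$. A pseudo-Kähler metric on a real Lie algebra $\mathfrak g$ is a bilinear form $\langle x,y\rangle=\Omega(Jx,y)$, where $J\in\mathrm{End}(\mathfrak g)$ satisfies $J^2=-\mathrm{id}$ and $[x,y]-[Jx,Jy]+J[Jx,y]+J[x,Jy]=0$ for all $x,y$, and $\Omega$ is a closed nondegenerate alternating bilinear form on $\mathfrak g$ with $\Omega(Jx,Jy)=\Omega(x,y)$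 for all $x,y$. (Such a form is symmetric and nondegenerate.) Two metrics $\langle\cdot,\cdot\rangle$ and $\langle\cdot,\cdot\rangle'$ on $\mathfrak g$ are equivalent if there is a Lie algebra automorphism $F$ of $\mathfrak g$ with $\langle Fx,Fy\rangle=\langle x,y\rangle'$ for all $x,y$. With $\nabla$ the Levi-Civita connection of a metric on left invariant vector fields, $R(x,y)=[\nabla_x,\nabla_y]-\nabla_{[x,y]}$ and $\rho(x,y)=\mathrm{Tr}(z\mapsto R(z,x)y)$, the metric is flat if $R=0$ and Ricci-flat if $\rho=0$. Then: 1. $T^*\mathfrak h_3$ admits a pseudo-Kähler metric that is Ricci-flat but not flat. 2. For every pseudo-Kähler metric on $T^*\mathfrak h_3$ there are a sign $\varepsilon\in\{1,-1\}$ and real numbers $m_{11},m_{12}$ with $m_{12}\neq0$ such that the metric is equivalent to the one whose matrix in the basis $(e_1,\dots,e_6)$ is $$\begin{pmatrix}\varepsilon E_{10}&M\\ M^{T}&\varepsilon E_{10}\end{pmatrix},\qquad E_{10}=\begin{pmatrix}0&0&0\\0&0&0\\0&0&1\end{pmatrix},\qquad M=\begin{pmatrix}m_{11}&m_{12}&0\\-m_{12}&m_{11}&0\\0&0&0\end{pmatrix}.$$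 -/

import Mathlib

noncomputable section

namespace PseudoKahlerCotangent

/-! ### The cotangent algebra of a Lie algebra -/

/-- The cotangent algebra `T*𝔥 = 𝔥 ⋉ 𝔥*` of a Lie algebra `𝔥`, with elements `(base, fiber)`. -/
@[ext]
structure CotangentAlgebra (𝔥 : Type*) [LieRing 𝔥] [LieAlgebra ℝ 𝔥] where
  base : 𝔥
  fiber : Module.Dual ℝ 𝔥

namespace CotangentAlgebra

variable {𝔥 : Type*} [LieRing 𝔥] [LieAlgebra ℝ 𝔥]

/-- `T*𝔥` is `𝔥 × 𝔥*` as a set; its vector space structure is that of the product. -/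
def equivProd : CotangentAlgebra 𝔥 ≃ 𝔥 × Module.Dual ℝ 𝔥 where
  toFun u := (u.base, u.fiber)
  invFun p := ⟨p.1, p.2⟩
  left_inv _ := rfl
  right_inv _ := rfl

instance : AddCommGroup (CotangentAlgebra 𝔥) := equivProd.addCommGroup

instance : Module ℝ (CotangentAlgebra 𝔥) := equivProd.module ℝ

@[simp] theorem zero_base : (0 : CotangentAlgebra 𝔥).base = 0 := rfl
@[simp] theorem zero_fiber : (0 : CotangentAlgebra 𝔥).fiber = 0 := rfl
@[simp] theorem add_base (u v : CotangentAlgebra 𝔥) : (u + v).base = u.base + v.base := rfl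
@[simp] theorem add_fiber (u v : CotangentAlgebra 𝔥) : (u + v).fiber = u.fiber + v.fiber := rfl
@[simp] theorem neg_base (u : CotangentAlgebra 𝔥) : (-u).base = -u.base := rfl
@[simp] theorem neg_fiber (u : CotangentAlgebra 𝔥) : (-u).fiber = -u.fiber := rfl
@[simp] theorem smul_base (c : ℝ) (u : CotangentAlgebra 𝔥) : (c • u).base = c • u.base := rfl
@[simp] theorem smul_fiber (c : ℝ) (u : CotangentAlgebra 𝔥) : (c • u).fiber = c • u.fiber := rfl

/-- The identification of `T*𝔥` with `𝔥 × 𝔥*` as vector spaces. -/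
def linearEquivProd : CotangentAlgebra 𝔥 ≃ₗ[ℝ] 𝔥 × Module.Dual ℝ 𝔥 where
  __ := equivProd
  map_add' _ _ := rfl
  map_smul' _ _ := rfl

/-- `[(x, φ), (y, ψ)] = ([x, y], ad*(x) ψ - ad*(y) φ)`. Here `⁅x, ψ⁆` is the coadjoint action of
Mathlib, `⁅x, ψ⁆ z = - ψ ⁅x, z⁆` (see `Module.Dual.lie_apply`). -/
instance : Bracket (CotangentAlgebra 𝔥) (CotangentAlgebra 𝔥) where
  bracket u v := ⟨⁅u.base, v.base⁆, ⁅u.base, v.fiber⁆ - ⁅v.base, u.fiber⁆⟩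

@[simp] theorem lie_base (u v : CotangentAlgebra 𝔥) : ⁅u, v⁆.base = ⁅u.base, v.base⁆ := rfl
@[simp] theorem lie_fiber (u v : CotangentAlgebra 𝔥) :
    ⁅u, v⁆.fiber = ⁅u.base, v.fiber⁆ - ⁅v.base, u.fiber⁆ := rfl

instance : LieRing (CotangentAlgebra 𝔥) where
  add_lie u v w := by
    ext1
    · simp
    · simp only [lie_fiber, add_fiber, add_base, add_lie, lie_add]; abel
  lie_add u v w := by
    ext1
    · simp
    · simp only [lie_fiber, add_fiber, add_base, add_lie, lie_add]; abel
  lie_self u := by ext1 <;> simp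
  leibniz_lie u v w := by
    ext1
    · simp
    · simp only [lie_fiber, lie_base, add_fiber, lie_sub, lie_lie]; abel

instance : LieAlgebra ℝ (CotangentAlgebra 𝔥) where
  lie_smul c u v := by
    ext1
    · simp
    · refine LinearMap.ext fun z => ?_
      simp [sub_eq_add_neg]

end CotangentAlgebra

/-! ### The Heisenberg algebra and its cotangent algebra -/

/-- The Heisenberg algebra `𝔥₃`, with elements `c₁ x₁ + c₂ x₂ + c₃ x₃`. -/
@[ext]
structure Heisenberg where
  c₁ : ℝ
  c₂ : ℝ
  c₃ : ℝ

namespace Heisenberg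

/-- The coordinates on `𝔥₃`; the vector space structure is that of `ℝ³`. -/
def equivFun : Heisenberg ≃ (Fin 3 → ℝ) where
  toFun u := ![u.c₁, u.c₂, u.c₃]
  invFun f := ⟨f 0, f 1, f 2⟩
  left_inv _ := rfl
  right_inv f := by ext i; fin_cases i <;> rfl

instance : AddCommGroup Heisenberg := equivFun.addCommGroup

instance : Module ℝ Heisenberg := equivFun.module ℝ

@[simp] theorem zero_c₁ : (0 : Heisenberg).c₁ = 0 := rfl
@[simp] theorem zero_c₂ : (0 : Heisenberg).c₂ = 0 := rfl
@[simp] theorem zero_c₃ : (0 : Heisenberg).c₃ = 0 := rfl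
@[simp] theorem add_c₁ (u v : Heisenberg) : (u + v).c₁ = u.c₁ + v.c₁ := rfl
@[simp] theorem add_c₂ (u v : Heisenberg) : (u + v).c₂ = u.c₂ + v.c₂ := rfl
@[simp] theorem add_c₃ (u v : Heisenberg) : (u + v).c₃ = u.c₃ + v.c₃ := rfl
@[simp] theorem smul_c₁ (c : ℝ) (u : Heisenberg) : (c • u).c₁ = c * u.c₁ := rfl
@[simp] theorem smul_c₂ (c : ℝ) (u : Heisenberg) : (c • u).c₂ = c * u.c₂ := rfl
@[simp] theorem smul_c₃ (c : ℝ) (u : Heisenberg) : (c • u).c₃ = c * u.c₃ := rfl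

/-- The bracket of `𝔥₃`: in the basis `x₁, x₂, x₃` the only nonzero one is `[x₁, x₂] = x₃`. -/
instance : Bracket Heisenberg Heisenberg where
  bracket u v := ⟨0, 0, u.c₁ * v.c₂ - u.c₂ * v.c₁⟩

@[simp] theorem lie_c₁ (u v : Heisenberg) : ⁅u, v⁆.c₁ = 0 := rfl
@[simp] theorem lie_c₂ (u v : Heisenberg) : ⁅u, v⁆.c₂ = 0 := rfl
@[simp] theorem lie_c₃ (u v : Heisenberg) : ⁅u, v⁆.c₃ = u.c₁ * v.c₂ - u.c₂ * v.c₁ := rfl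

instance : LieRing Heisenberg where
  add_lie u v w := by ext <;> simp; ring
  lie_add u v w := by ext <;> simp; ring
  lie_self u := by ext <;> simp; ring
  leibniz_lie u v w := by ext <;> simp

instance : LieAlgebra ℝ Heisenberg where
  lie_smul c u v := by ext <;> simp; ring

/-- The basis `x₁, x₂, x₃` of `𝔥₃`. -/
def basis : Module.Basis (Fin 3) ℝ Heisenberg :=
  Module.Basis.ofEquivFun
    { equivFun with
      map_add' := fun u v => by
        ext i; fin_cases i <;> rfl
      map_smul' := fun c u => by
        ext i; fin_cases i <;> rfl }

end Heisenberg

/-- The Lie algebra `T*𝔥₃`. -/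
abbrev CotangentHeisenberg : Type := CotangentAlgebra Heisenberg

/-- The permutation that turns the basis `(x₁, x₂, x₃ ∣ x¹, x², x³)` of `𝔥₃ × 𝔥₃*` into
`(x₁, x₂, x³ ∣ x¹, x², x₃)`. -/
def swapThird : Equiv.Perm (Fin 3 ⊕ Fin 3) := Equiv.swap (Sum.inl 2) (Sum.inr 2)

/-- The basis `(e₁, e₂, e₃ ∣ e₄, e₅, e₆) = (x₁, x₂, x³ ∣ x¹, x², x₃)` of `T*𝔥₃`, where
`x¹, x², x³` is the basis of `𝔥₃*` dual to the basis `x₁, x₂, x₃` of `𝔥₃`. The vectors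
`e₁, e₂, e₃` are indexed by the left and `e₄, e₅, e₆` by the right summand of `Fin 3 ⊕ Fin 3`.
The nonzero brackets are `[e₁, e₂] = e₆`, `[e₁, e₃] = -e₅`, `[e₂, e₃] = e₄`, see below. -/
def basisE : Module.Basis (Fin 3 ⊕ Fin 3) ℝ CotangentHeisenberg :=
  ((Heisenberg.basis.prod Heisenberg.basis.dualBasis).map
    CotangentAlgebra.linearEquivProd.symm).reindex swapThird

section Brackets

open Heisenberg

theorem Heisenberg.repr_zero (u : Heisenberg) : basis.repr u 0 = u.c₁ := by
  change equivFun u 0 = u.c₁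
  rfl

theorem Heisenberg.repr_one (u : Heisenberg) : basis.repr u 1 = u.c₂ := by
  change equivFun u 1 = u.c₂
  rfl

theorem Heisenberg.repr_two (u : Heisenberg) : basis.repr u 2 = u.c₃ := by
  change equivFun u 2 = u.c₃
  rfl

theorem Heisenberg.basis_zero : basis 0 = ⟨1, 0, 0⟩ := by
  ext <;> simp [← repr_zero, ← repr_one, ← repr_two]

theorem Heisenberg.basis_one : basis 1 = ⟨0, 1, 0⟩ := by
  ext <;> simp [← repr_zero, ← repr_one, ← repr_two]

theorem Heisenberg.basis_two : basis 2 = ⟨0, 0, 1⟩ := by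
  ext <;> simp [← repr_zero, ← repr_one, ← repr_two]

theorem basisE_eq (k : Fin 3 ⊕ Fin 3) :
    basisE k = CotangentAlgebra.linearEquivProd.symm
      (basis.prod basis.dualBasis (swapThird.symm k)) := by
  simp [basisE]

theorem basisE_inl_zero : basisE (.inl 0) = ⟨⟨1, 0, 0⟩, 0⟩ := by
  rw [basisE_eq, show swapThird.symm (Sum.inl 0) = Sum.inl 0 by decide,
    ← Heisenberg.basis_zero, Module.Basis.prod_apply]
  rfl

theorem basisE_inl_one : basisE (.inl 1) = ⟨⟨0, 1, 0⟩, 0⟩ := by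
  rw [basisE_eq, show swapThird.symm (Sum.inl 1) = Sum.inl 1 by decide,
    ← Heisenberg.basis_one, Module.Basis.prod_apply]
  rfl

theorem basisE_inl_two : basisE (.inl 2) = ⟨0, basis.dualBasis 2⟩ := by
  rw [basisE_eq, show swapThird.symm (Sum.inl 2) = Sum.inr 2 by decide, Module.Basis.prod_apply]
  rfl

theorem basisE_inr_zero : basisE (.inr 0) = ⟨0, basis.dualBasis 0⟩ := by
  rw [basisE_eq, show swapThird.symm (Sum.inr 0) = Sum.inr 0 by decide, Module.Basis.prod_apply]
  rfl

theorem basisE_inr_one : basisE (.inr 1) = ⟨0, basis.dualBasis 1⟩ := by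
  rw [basisE_eq, show swapThird.symm (Sum.inr 1) = Sum.inr 1 by decide, Module.Basis.prod_apply]
  rfl

theorem basisE_inr_two : basisE (.inr 2) = ⟨⟨0, 0, 1⟩, 0⟩ := by
  rw [basisE_eq, show swapThird.symm (Sum.inr 2) = Sum.inl 2 by decide,
    ← Heisenberg.basis_two, Module.Basis.prod_apply]
  rfl

theorem lie_e₁_e₂ : ⁅basisE (.inl 0), basisE (.inl 1)⁆ = basisE (.inr 2) := by
  rw [basisE_inl_zero, basisE_inl_one, basisE_inr_two]
  ext <;> simp

theorem lie_e₁_e₃ : ⁅basisE (.inl 0), basisE (.inl 2)⁆ = -basisE (.inr 1) := by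
  rw [basisE_inl_zero, basisE_inl_two, basisE_inr_one]
  ext <;> simp [repr_one, repr_two]

theorem lie_e₂_e₃ : ⁅basisE (.inl 1), basisE (.inl 2)⁆ = basisE (.inr 0) := by
  rw [basisE_inl_one, basisE_inl_two, basisE_inr_zero]
  ext <;> simp [repr_zero, repr_two]

theorem lie_center (i : Fin 3) (u : CotangentHeisenberg) : ⁅basisE (.inr i), u⁆ = 0 := by
  fin_cases i
  · change ⁅basisE (.inr 0), u⁆ = 0
    rw [basisE_inr_zero]; ext <;> simp [repr_zero]
  · change ⁅basisE (.inr 1), u⁆ = 0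
    rw [basisE_inr_one]; ext <;> simp [repr_one]
  · change ⁅basisE (.inr 2), u⁆ = 0
    rw [basisE_inr_two]
    have h : ∀ w : Heisenberg, ⁅(⟨0, 0, 1⟩ : Heisenberg), w⁆ = 0 := fun w => by ext <;> simp
    ext <;> simp [h]

end Brackets

/-! ### Metrics, connections and curvature on a real Lie algebra -/

section Metric

variable {𝔤 : Type*} [LieRing 𝔤] [LieAlgebra ℝ 𝔤]

/-- `nab x y = ∇_x y` is the Levi-Civita connection of the metric `g` on left invariant vector
fields: it is torsion free and `g` is parallel. For a metric, i.e. a nondegenerate symmetric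
bilinear form `g`, exactly one such `nab` exists. -/
structure IsLeviCivita (g : LinearMap.BilinForm ℝ 𝔤) (nab : 𝔤 →ₗ[ℝ] Module.End ℝ 𝔤) : Prop where
  torsion_free : ∀ x y, nab x y - nab y x = ⁅x, y⁆
  metric : ∀ x y z, g (nab x y) z + g y (nab x z) = 0

/-- The curvature operator `R(x, y) = ∇_x ∇_y - ∇_y ∇_x - ∇_[x,y]`. -/
def curvature (nab : 𝔤 →ₗ[ℝ] Module.End ℝ 𝔤) (x y : 𝔤) : Module.End ℝ 𝔤 :=
  nab x * nab y - nab y * nab x - nab ⁅x, y⁆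

/-- The linear map `z ↦ R(z, x) y`. -/
def ricciMap (nab : 𝔤 →ₗ[ℝ] Module.End ℝ 𝔤) (x y : 𝔤) : Module.End ℝ 𝔤 where
  toFun z := curvature nab z x y
  map_add' z w := by
    simp only [curvature, map_add, add_lie, LinearMap.sub_apply, LinearMap.add_apply,
      Module.End.mul_apply]
    abel
  map_smul' c z := by
    simp only [curvature, map_smul, smul_lie, LinearMap.sub_apply, LinearMap.smul_apply,
      Module.End.mul_apply, RingHom.id_apply, smul_sub]

/-- The Ricci tensor `ρ(x, y) = Tr (z ↦ R(z, x) y)`. -/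
def ricci (nab : 𝔤 →ₗ[ℝ] Module.End ℝ 𝔤) (x y : 𝔤) : ℝ :=
  LinearMap.trace ℝ 𝔤 (ricciMap nab x y)

/-- The metric `g` is flat: the curvature of its (unique) Levi-Civita connection is zero. -/
def IsFlat (g : LinearMap.BilinForm ℝ 𝔤) : Prop :=
  ∃ nab, IsLeviCivita g nab ∧ ∀ x y, curvature nab x y = 0

/-- The metric `g` is Ricci-flat: the Ricci tensor of its (unique) Levi-Civita connection is
zero. -/
def IsRicciFlat (g : LinearMap.BilinForm ℝ 𝔤) : Prop :=
  ∃ nab, IsLeviCivita g nab ∧ ∀ x y, ricci nab x y = 0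

/-! ### Pseudo-Kähler metrics -/

/-- `J` is a complex structure on `𝔤`: `J² = -id` and the Nijenhuis tensor of `J` vanishes. -/
structure IsComplexStructure (J : Module.End ℝ 𝔤) : Prop where
  sq : ∀ x, J (J x) = -x
  nijenhuis : ∀ x y, ⁅x, y⁆ - ⁅J x, J y⁆ + J ⁅J x, y⁆ + J ⁅x, J y⁆ = 0

/-- `Ω` is a symplectic structure on `𝔤`: a closed 2-form of maximal rank. Closedness is
`dΩ(x, y, z) = -Ω([x, y], z) - Ω([y, z], x) - Ω([z, x], y) = 0`. -/
structure IsSymplecticStructure (Ω : LinearMap.BilinForm ℝ 𝔤) : Prop where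
  alt : Ω.IsAlt
  closed : ∀ x y z, Ω ⁅x, y⁆ z + Ω ⁅y, z⁆ x + Ω ⁅z, x⁆ y = 0
  nondegenerate : Ω.Nondegenerate

/-- `(J, Ω)` is a pseudo-Kähler structure on `𝔤`. -/
structure IsPseudoKahlerStructure (J : Module.End ℝ 𝔤) (Ω : LinearMap.BilinForm ℝ 𝔤) : Prop where
  complex : IsComplexStructure J
  symplectic : IsSymplecticStructure Ω
  compatible : ∀ x y, Ω (J x) (J y) = Ω x y

/-- `g` is a pseudo-Kähler metric on `𝔤`: `g(x, y) = Ω(J x, y)` for a pseudo-Kähler structure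
`(J, Ω)`. Such a `g` is automatically symmetric and nondegenerate, see below. -/
def IsPseudoKahlerMetric (g : LinearMap.BilinForm ℝ 𝔤) : Prop :=
  ∃ (J : Module.End ℝ 𝔤) (Ω : LinearMap.BilinForm ℝ 𝔤),
    IsPseudoKahlerStructure J Ω ∧ ∀ x y, g x y = Ω (J x) y

theorem IsPseudoKahlerMetric.isSymm {g : LinearMap.BilinForm ℝ 𝔤}
    (hg : IsPseudoKahlerMetric g) : g.IsSymm := by
  obtain ⟨J, Ω, h, hgΩ⟩ := hg
  refine ⟨fun x y => ?_⟩
  rw [hgΩ, hgΩ, ← h.compatible (J x) y, h.complex.sq, map_neg, LinearMap.neg_apply,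
    ← h.symplectic.alt.neg_eq (J y) x]
  simp

theorem IsPseudoKahlerMetric.nondegenerate {g : LinearMap.BilinForm ℝ 𝔤}
    (hg : IsPseudoKahlerMetric g) : g.Nondegenerate := by
  have hs := hg.isSymm
  obtain ⟨J, Ω, h, hgΩ⟩ := hg
  have hr : ∀ y, (∀ x, g x y = 0) → y = 0 := fun y hy => by
    refine h.symplectic.nondegenerate.2 y fun x => ?_
    have := hy (J x)
    rw [hgΩ, h.complex.sq, map_neg, LinearMap.neg_apply, neg_eq_zero] at this
    exact this
  exact ⟨fun x hx => hr x fun y => by rw [hs.eq]; exact hx y, hr⟩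

/-- Two metrics on `𝔤` are equivalent if a Lie algebra automorphism of `𝔤` is an isometry
between them. -/
def AreEquivalent (g h : LinearMap.BilinForm ℝ 𝔤) : Prop :=
  ∃ F : 𝔤 ≃ₗ⁅ℝ⁆ 𝔤, ∀ x y, g (F x) (F y) = h x y

end Metric

/-! ### The normal form -/

/-- The `3 × 3` matrix `E₁₀ = diag(0, 0, 1)`. -/
def E10 : Matrix (Fin 3) (Fin 3) ℝ := !![0, 0, 0; 0, 0, 0; 0, 0, 1]

/-- The rotation-type matrix with entries `a` and `b`. -/
def rotM (a b : ℝ) : Matrix (Fin 3) (Fin 3) ℝ := !![a, b, 0; -b, a, 0; 0, 0, 0]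

/-- The bilinear form on `T*𝔥₃` whose matrix in the basis `e` has the blocks `S, M, Mᵀ, E`. -/
def blockMetric (S M E : Matrix (Fin 3) (Fin 3) ℝ) : LinearMap.BilinForm ℝ CotangentHeisenberg :=
  Matrix.toBilin basisE (Matrix.fromBlocks S M M.transpose E)

end PseudoKahlerCotangent

end

open PseudoKahlerCotangent

namespace PseudoKahlerCotangent

/-! ### Coordinates on `T*𝔥₃` -/

/-! Modulo its centre `T*𝔥₃` is `ℝ³`, its centre is another `ℝ³`, and the bracket is the cross
product from the first to the second. It is thus free 2-step nilpotent on three generators, and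
automorphisms are obtained by choosing three vectors independent modulo the centre.

For the classification, let `J` be a complex structure. The 3-dimensional centre is not
`J`-invariant, so `J u` is non-central for some central `u`, and the Nijenhuis identity then says
that `ad (J u)` commutes with `J`. From this one finds `b` such that, with `q = [b, J b]` and `p =
[J q, b]`, the vectors `b, J b, J q, p, J p, q` form a basis (`exists_generator`). In this basis
both `J` and the bracket have universal constants, so `J` is unique up to automorphism and the only
freedom left is the choice of `b`.

A compatible closed form is determined in this frame by `N = Ω(b, J b)`, `S = Ω(b, q)`, `T = Ω(J b,
q)`, `Q = Ω(b, p)` and `P = Ω(J b, p)` (`form_frame`), and nondegeneracy forces `P ≠ 0`. Replacing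
`b` by `b + c J q + d q` kills `S` and `T`, adding a multiple of `p` kills `N`, and scaling makes
`|2P| = 1`. What remains is `Q` and the sign of `P`, which is the normal form.

For existence, an explicit metric has curvature that sees only the `e₁, e₂` coordinates and takes
values in the centre: it is nonzero, but its Ricci traces vanish. -/

/-- The coordinates of `T*𝔥₃` along the generators `e₁, e₂, e₃`. -/
noncomputable def gen (i : Fin 3) : CotangentHeisenberg →ₗ[ℝ] ℝ := basisE.coord (.inl i)

/-- The coordinates of `T*𝔥₃` along the central vectors `e₄, e₅, e₆`. -/
noncomputable def cen (i : Fin 3) : CotangentHeisenberg →ₗ[ℝ] ℝ := basisE.coord (.inr i)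

@[simp] theorem gen_basisE_inl (i j : Fin 3) : gen i (basisE (.inl j)) = if j = i then 1 else 0 := by
  simp [gen, Finsupp.single_apply]

@[simp] theorem gen_basisE_inr (i j : Fin 3) : gen i (basisE (.inr j)) = 0 := by
  simp [gen]

@[simp] theorem cen_basisE_inl (i j : Fin 3) : cen i (basisE (.inl j)) = 0 := by
  simp [cen]

@[simp] theorem cen_basisE_inr (i j : Fin 3) : cen i (basisE (.inr j)) = if j = i then 1 else 0 := by
  simp [cen, Finsupp.single_apply]

theorem eq_sum_coords (x : CotangentHeisenberg) :
    x = gen 0 x • basisE (.inl 0) + gen 1 x • basisE (.inl 1) + gen 2 x • basisE (.inl 2) +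
      cen 0 x • basisE (.inr 0) + cen 1 x • basisE (.inr 1) + cen 2 x • basisE (.inr 2) := by
  conv_lhs => rw [← basisE.sum_repr x]
  simp only [Fintype.sum_sum_type, Fin.sum_univ_three, gen, cen, Module.Basis.coord_apply]
  abel

theorem ext_coords {x y : CotangentHeisenberg} (h₀ : gen 0 x = gen 0 y) (h₁ : gen 1 x = gen 1 y)
    (h₂ : gen 2 x = gen 2 y) (h₃ : cen 0 x = cen 0 y) (h₄ : cen 1 x = cen 1 y)
    (h₅ : cen 2 x = cen 2 y) : x = y := by
  rw [eq_sum_coords x, eq_sum_coords y, h₀, h₁, h₂, h₃, h₄, h₅]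

theorem lie_central (u : CotangentHeisenberg) (i : Fin 3) : ⁅u, basisE (.inr i)⁆ = 0 := by
  rw [← lie_skew, lie_center, neg_zero]

/-- The bracket is the cross product of the generator parts, placed in the centre; the polynomial
identities below are vector identities in `ℝ³`. -/
theorem lie_eq (x y : CotangentHeisenberg) :
    ⁅x, y⁆ = (gen 1 x * gen 2 y - gen 2 x * gen 1 y) • basisE (.inr 0) +
      (gen 2 x * gen 0 y - gen 0 x * gen 2 y) • basisE (.inr 1) +
      (gen 0 x * gen 1 y - gen 1 x * gen 0 y) • basisE (.inr 2) := by
  conv_lhs => rw [eq_sum_coords x, eq_sum_coords y]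
  have h₁ := lie_e₁_e₂
  have h₂ := lie_e₁_e₃
  have h₃ := lie_e₂_e₃
  have k₁ : ⁅basisE (.inl 1), basisE (.inl 0)⁆ = -basisE (.inr 2) := by rw [← lie_skew, h₁]
  have k₂ : ⁅basisE (.inl 2), basisE (.inl 0)⁆ = basisE (.inr 1) := by
    rw [← lie_skew, h₂, neg_neg]
  have k₃ : ⁅basisE (.inl 2), basisE (.inl 1)⁆ = -basisE (.inr 0) := by rw [← lie_skew, h₃]
  simp only [add_lie, lie_add, smul_lie, lie_smul, lie_center, lie_central, lie_self, h₁, h₂, h₃,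
    k₁, k₂, k₃]
  module

@[simp] theorem gen_lie (i : Fin 3) (x y : CotangentHeisenberg) : gen i ⁅x, y⁆ = 0 := by
  simp [lie_eq]

@[simp] theorem cen_zero_lie (x y : CotangentHeisenberg) :
    cen 0 ⁅x, y⁆ = gen 1 x * gen 2 y - gen 2 x * gen 1 y := by
  simp [lie_eq]

@[simp] theorem cen_one_lie (x y : CotangentHeisenberg) :
    cen 1 ⁅x, y⁆ = gen 2 x * gen 0 y - gen 0 x * gen 2 y := by
  simp [lie_eq]

@[simp] theorem cen_two_lie (x y : CotangentHeisenberg) :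
    cen 2 ⁅x, y⁆ = gen 0 x * gen 1 y - gen 1 x * gen 0 y := by
  simp [lie_eq]

/-- The element of `T*𝔥₃` with given coordinates. -/
noncomputable def ofCoords (a b c d e f : ℝ) : CotangentHeisenberg :=
  a • basisE (.inl 0) + b • basisE (.inl 1) + c • basisE (.inl 2) +
    d • basisE (.inr 0) + e • basisE (.inr 1) + f • basisE (.inr 2)

section ofCoords

variable (a b c d e f : ℝ)

@[simp] theorem gen_zero_ofCoords : gen 0 (ofCoords a b c d e f) = a := by simp [ofCoords]
@[simp] theorem gen_one_ofCoords : gen 1 (ofCoords a b c d e f) = b := by simp [ofCoords]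
@[simp] theorem gen_two_ofCoords : gen 2 (ofCoords a b c d e f) = c := by simp [ofCoords]
@[simp] theorem cen_zero_ofCoords : cen 0 (ofCoords a b c d e f) = d := by simp [ofCoords]
@[simp] theorem cen_one_ofCoords : cen 1 (ofCoords a b c d e f) = e := by simp [ofCoords]
@[simp] theorem cen_two_ofCoords : cen 2 (ofCoords a b c d e f) = f := by simp [ofCoords]

end ofCoords

/-! ### Automorphisms of `T*𝔥₃` -/

/-- The determinant of the classes of three vectors modulo the centre of `T*𝔥₃`. -/
noncomputable def vol (x y z : CotangentHeisenberg) : ℝ :=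
  gen 0 x * (gen 1 y * gen 2 z - gen 2 y * gen 1 z) +
    gen 1 x * (gen 2 y * gen 0 z - gen 0 y * gen 2 z) +
    gen 2 x * (gen 0 y * gen 1 z - gen 1 y * gen 0 z)

/-- `T*𝔥₃` is the free 2-step nilpotent Lie algebra on `e₁, e₂, e₃`: three vectors that are
independent modulo the centre are the images of the generators under an automorphism. -/
theorem exists_lieEquiv_of_vol_ne_zero (v w x : CotangentHeisenberg) (h : vol v w x ≠ 0) :
    ∃ F : CotangentHeisenberg ≃ₗ⁅ℝ⁆ CotangentHeisenberg, ∀ y,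
      F y = gen 0 y • v + gen 1 y • w + gen 2 y • x +
        cen 0 y • ⁅w, x⁆ + cen 1 y • ⁅x, v⁆ + cen 2 y • ⁅v, w⁆ := by
  let f : CotangentHeisenberg →ₗ[ℝ] CotangentHeisenberg :=
    (gen 0).smulRight v + (gen 1).smulRight w + (gen 2).smulRight x +
      (cen 0).smulRight ⁅w, x⁆ + (cen 1).smulRight ⁅x, v⁆ + (cen 2).smulRight ⁅v, w⁆
  have hf : ∀ y, f y = gen 0 y • v + gen 1 y • w + gen 2 y • x +
      cen 0 y • ⁅w, x⁆ + cen 1 y • ⁅x, v⁆ + cen 2 y • ⁅v, w⁆ := fun y => rfl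
  have hlie : ∀ y z, f ⁅y, z⁆ = ⁅f y, f z⁆ := fun y z => by
    rw [hf, hf, hf]
    apply ext_coords <;> simp only [map_add, map_smul, smul_eq_mul, gen_lie, cen_zero_lie,
      cen_one_lie, cen_two_lie] <;> ring
  have hinj : Function.Injective f := by
    refine (injective_iff_map_eq_zero f).2 fun y hy => ?_
    rw [hf] at hy
    have g₀ := congrArg (gen 0) hy
    have g₁ := congrArg (gen 1) hy
    have g₂ := congrArg (gen 2) hy
    have c₀ := congrArg (cen 0) hy
    have c₁ := congrArg (cen 1) hy
    have c₂ := congrArg (cen 2) hy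
    simp at g₀ g₁ g₂ c₀ c₁ c₂
    -- Cramer's rule: pairing with the cross product of `w` and `x` eliminates both and leaves `vol
    -- v w x`.
    have y₀ : gen 0 y = 0 := (mul_eq_zero.1 (show vol v w x * gen 0 y = 0 by
      unfold vol
      linear_combination (gen 1 w * gen 2 x - gen 2 w * gen 1 x) * g₀ +
        (gen 2 w * gen 0 x - gen 0 w * gen 2 x) * g₁ +
        (gen 0 w * gen 1 x - gen 1 w * gen 0 x) * g₂)).resolve_left h
    have y₁ : gen 1 y = 0 := (mul_eq_zero.1 (show vol v w x * gen 1 y = 0 by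
      unfold vol
      linear_combination (gen 1 x * gen 2 v - gen 2 x * gen 1 v) * g₀ +
        (gen 2 x * gen 0 v - gen 0 x * gen 2 v) * g₁ +
        (gen 0 x * gen 1 v - gen 1 x * gen 0 v) * g₂)).resolve_left h
    have y₂ : gen 2 y = 0 := (mul_eq_zero.1 (show vol v w x * gen 2 y = 0 by
      unfold vol
      linear_combination (gen 1 v * gen 2 w - gen 2 v * gen 1 w) * g₀ +
        (gen 2 v * gen 0 w - gen 0 v * gen 2 w) * g₁ +
        (gen 0 v * gen 1 w - gen 1 v * gen 0 w) * g₂)).resolve_left h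
    simp only [y₀, y₁, y₂, zero_mul, zero_add] at c₀ c₁ c₂
    -- Only the three brackets remain, and they are dual to `v, w, x` up to the factor `vol v w x`.
    have y₃ : cen 0 y = 0 := (mul_eq_zero.1 (show vol v w x * cen 0 y = 0 by
      unfold vol
      linear_combination gen 0 v * c₀ + gen 1 v * c₁ + gen 2 v * c₂)).resolve_left h
    have y₄ : cen 1 y = 0 := (mul_eq_zero.1 (show vol v w x * cen 1 y = 0 by
      unfold vol
      linear_combination gen 0 w * c₀ + gen 1 w * c₁ + gen 2 w * c₂)).resolve_left h
    have y₅ : cen 2 y = 0 := (mul_eq_zero.1 (show vol v w x * cen 2 y = 0 by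
      unfold vol
      linear_combination gen 0 x * c₀ + gen 1 x * c₁ + gen 2 x * c₂)).resolve_left h
    apply ext_coords <;> simp [y₀, y₁, y₂, y₃, y₄, y₅]
  have : FiniteDimensional ℝ CotangentHeisenberg := basisE.finiteDimensional_of_finite
  have hsurj : Function.Surjective f := LinearMap.injective_iff_surjective.1 hinj
  let φ : CotangentHeisenberg →ₗ⁅ℝ⁆ CotangentHeisenberg := { f with map_lie' := hlie _ _ }
  exact ⟨LieEquiv.ofBijective φ ⟨hinj, hsurj⟩, hf⟩

/-! ### Uniqueness of the Levi-Civita connection -/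

/-- The difference of two such connections gives a trilinear form symmetric in its first two
arguments and skew in its last two; such a form is zero. -/
theorem IsLeviCivita.unique {𝔤 : Type*} [LieRing 𝔤] [LieAlgebra ℝ 𝔤]
    {g : LinearMap.BilinForm ℝ 𝔤} (hs : g.IsSymm) (hn : g.Nondegenerate)
    {D D' : 𝔤 →ₗ[ℝ] Module.End ℝ 𝔤} (h : IsLeviCivita g D) (h' : IsLeviCivita g D') :
    D = D' := by
  have skew : ∀ x y z, g ((D - D') x y) z = -g ((D - D') x z) y := fun x y z => by
    have h₁ := h.metric x y z
    have h₂ := h'.metric x y z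
    have s₁ := hs.eq y (D x z)
    have s₂ := hs.eq y (D' x z)
    simp only [LinearMap.sub_apply, map_sub]
    linear_combination h₁ - h₂ - s₁ + s₂
  have symm : ∀ x y, (D - D') x y = (D - D') y x := fun x y => by
    have h₁ := h.torsion_free x y
    rw [← h'.torsion_free x y] at h₁
    exact sub_eq_sub_iff_sub_eq_sub.1 h₁
  refine LinearMap.ext fun x => LinearMap.ext fun y => sub_eq_zero.1 ?_
  refine hn.1 _ fun z => ?_
  change g ((D - D') x y) z = 0
  have e₁ := skew x y z
  have e₂ := skew z x y
  have e₃ := skew y z x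
  rw [symm z x] at e₂
  rw [symm z y] at e₂
  rw [symm y x] at e₃
  linear_combination (e₁ + e₃ - e₂) / 2

/-! ### A Ricci-flat metric that is not flat -/

/-- The complex structure with `J e₁ = e₂`, `J e₄ = e₅`, `J e₆ = e₃`. -/
noncomputable def modelJ : Module.End ℝ CotangentHeisenberg where
  toFun x := ofCoords (-gen 1 x) (gen 0 x) (cen 2 x) (-cen 1 x) (cen 0 x) (-gen 2 x)
  map_add' x y := by apply ext_coords <;> simp <;> ring
  map_smul' c x := by apply ext_coords <;> simp

/-- The symplectic form `e⁴ ∧ e¹ + e⁵ ∧ e² - 2 e⁶ ∧ e³`. -/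
noncomputable def modelForm : LinearMap.BilinForm ℝ CotangentHeisenberg :=
  -- The factor 2 is forced by closedness on `e₁, e₂, e₃`: the three pairings must sum to zero.
  LinearMap.mk₂ ℝ (fun x y => cen 0 x * gen 0 y - gen 0 x * cen 0 y +
      (cen 1 x * gen 1 y - gen 1 x * cen 1 y) - 2 * (cen 2 x * gen 2 y - gen 2 x * cen 2 y))
    (fun x y z => by simp only [map_add]; ring)
    (fun c x y => by simp only [map_smul, smul_eq_mul]; ring)
    (fun x y z => by simp only [map_add]; ring)
    (fun c x y => by simp only [map_smul, smul_eq_mul]; ring)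

theorem modelForm_apply (x y : CotangentHeisenberg) :
    modelForm x y = cen 0 x * gen 0 y - gen 0 x * cen 0 y +
      (cen 1 x * gen 1 y - gen 1 x * cen 1 y) - 2 * (cen 2 x * gen 2 y - gen 2 x * cen 2 y) :=
  rfl

theorem modelJ_apply (x : CotangentHeisenberg) :
    modelJ x = ofCoords (-gen 1 x) (gen 0 x) (cen 2 x) (-cen 1 x) (cen 0 x) (-gen 2 x) := rfl

theorem isPseudoKahlerStructure_model : IsPseudoKahlerStructure modelJ modelForm where
  complex :=
    { sq := fun x => by apply ext_coords <;> simp [modelJ_apply]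
      nijenhuis := fun x y => by
        apply ext_coords <;> simp [modelJ_apply] <;> ring }
  symplectic :=
    { alt := fun x => by rw [modelForm_apply]; ring
      closed := fun x y z => by simp [modelForm_apply]; ring
      nondegenerate := by
        have hr : ∀ y, (∀ x, modelForm x y = 0) → y = 0 := fun y hy => by
          have h₀ := hy (basisE (.inr 0))
          have h₁ := hy (basisE (.inr 1))
          have h₂ := hy (basisE (.inr 2))
          have h₃ := hy (basisE (.inl 0))
          have h₄ := hy (basisE (.inl 1))
          have h₅ := hy (basisE (.inl 2))
          simp [modelForm_apply] at h₀ h₁ h₂ h₃ h₄ h₅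
          apply ext_coords <;> simp [*]
        refine ⟨fun x hx => hr x fun y => ?_, hr⟩
        have := hx y
        rw [modelForm_apply] at this ⊢
        linear_combination -this }
  compatible := fun x y => by simp [modelForm_apply, modelJ_apply]; ring

/-- The metric `modelForm (modelJ x) y`. -/
noncomputable def modelMetric : LinearMap.BilinForm ℝ CotangentHeisenberg :=
  modelForm.comp modelJ LinearMap.id

theorem modelMetric_apply (x y : CotangentHeisenberg) :
    modelMetric x y = -(gen 0 x * cen 1 y + cen 1 x * gen 0 y) +
      (gen 1 x * cen 0 y + cen 0 x * gen 1 y) + 2 * gen 2 x * gen 2 y + 2 * cen 2 x * cen 2 y := by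
  change modelForm (modelJ x) y = _
  simp [modelForm_apply, modelJ_apply]
  ring

theorem isPseudoKahlerMetric_model : IsPseudoKahlerMetric modelMetric :=
  ⟨modelJ, modelForm, isPseudoKahlerStructure_model, fun _ _ => rfl⟩

/-- The Levi-Civita connection of `modelMetric`. -/
noncomputable def modelConnection :
    CotangentHeisenberg →ₗ[ℝ] Module.End ℝ CotangentHeisenberg :=
  LinearMap.mk₂ ℝ (fun x y => ofCoords 0 0 (-(gen 0 x * gen 0 y + gen 1 x * gen 1 y) / 2)
      (-gen 0 x * cen 2 y + gen 1 x * gen 2 y - cen 2 x * gen 0 y)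
      (-gen 0 x * gen 2 y - gen 1 x * cen 2 y - cen 2 x * gen 1 y)
      ((gen 0 x * gen 1 y - gen 1 x * gen 0 y) / 2))
    (fun x y z => by apply ext_coords <;> simp <;> ring)
    (fun c x y => by apply ext_coords <;> simp <;> ring)
    (fun x y z => by apply ext_coords <;> simp <;> ring)
    (fun c x y => by apply ext_coords <;> simp <;> ring)

theorem modelConnection_apply (x y : CotangentHeisenberg) :
    modelConnection x y = ofCoords 0 0 (-(gen 0 x * gen 0 y + gen 1 x * gen 1 y) / 2)
      (-gen 0 x * cen 2 y + gen 1 x * gen 2 y - cen 2 x * gen 0 y)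
      (-gen 0 x * gen 2 y - gen 1 x * cen 2 y - cen 2 x * gen 1 y)
      ((gen 0 x * gen 1 y - gen 1 x * gen 0 y) / 2) :=
  rfl

theorem isLeviCivita_model : IsLeviCivita modelMetric modelConnection where
  torsion_free x y := by
    apply ext_coords <;> simp [modelConnection_apply] <;> ring
  metric x y z := by
    simp [modelConnection_apply, modelMetric_apply]
    ring

theorem curvature_model (x y z : CotangentHeisenberg) :
    curvature modelConnection x y z =
      (2 * (gen 0 x * gen 1 y - gen 1 x * gen 0 y)) • ofCoords 0 0 0 (gen 0 z) (gen 1 z) 0 := by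
  rw [curvature]
  apply ext_coords <;> simp [modelConnection_apply] <;> ring

theorem ricciMap_model (x y z : CotangentHeisenberg) :
    ricciMap modelConnection x y z =
      (2 * (gen 0 z * gen 1 x - gen 1 z * gen 0 x)) • ofCoords 0 0 0 (gen 0 y) (gen 1 y) 0 :=
  curvature_model z x y

/-- The map `z ↦ R(z, x) y` kills the centre and takes values in it, so it squares to zero and every
diagonal entry vanishes. -/
theorem isRicciFlat_model : IsRicciFlat modelMetric := by
  refine ⟨modelConnection, isLeviCivita_model, fun x y => ?_⟩
  rw [ricci, LinearMap.trace_eq_matrix_trace ℝ basisE, Matrix.trace]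
  refine Finset.sum_eq_zero fun i _ => ?_
  rw [Matrix.diag_apply, LinearMap.toMatrix_apply, ricciMap_model, ← Module.Basis.coord_apply]
  rcases i with i | i
  · rw [← gen, map_smul]
    have : ∀ i, gen i (ofCoords 0 0 0 (gen 0 y) (gen 1 y) 0) = 0 := fun i => by
      simp [ofCoords]
    rw [this, smul_zero]
  · simp only [gen_basisE_inr, zero_mul, sub_zero, mul_zero, zero_smul, map_zero]

theorem not_isFlat_model : ¬ IsFlat modelMetric := by
  rintro ⟨D, hD, h⟩
  rw [hD.unique isPseudoKahlerMetric_model.isSymm isPseudoKahlerMetric_model.nondegenerate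
    isLeviCivita_model] at h
  -- `R(e₁, e₂) e₁ = 2 e₄`.
  have := congrArg (cen 0) (LinearMap.congr_fun
    (h (basisE (.inl 0)) (basisE (.inl 1))) (basisE (.inl 0)))
  rw [curvature_model] at this
  simp at this

/-! ### Complex structures on `T*𝔥₃` -/

theorem lie_eq_zero_of_gen_eq_zero {u : CotangentHeisenberg} (hu : ∀ i, gen i u = 0)
    (x : CotangentHeisenberg) : ⁅u, x⁆ = 0 := by
  simp [lie_eq, hu]

theorem exists_lie_ne_zero {u : CotangentHeisenberg} (hu : ∃ i, gen i u ≠ 0) :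
    ∃ x : CotangentHeisenberg, ⁅u, x⁆ ≠ 0 := by
  by_contra! h
  obtain ⟨i, hi⟩ := hu
  have h₀ := congrArg (cen 2) (h (basisE (.inl 1)))
  have h₁ := congrArg (cen 0) (h (basisE (.inl 2)))
  have h₂ := congrArg (cen 1) (h (basisE (.inl 0)))
  simp at h₀ h₁ h₂
  fin_cases i <;> simp_all

namespace IsComplexStructure

variable {J : Module.End ℝ CotangentHeisenberg}

/-- The centre has odd dimension, so that it is not `J`-invariant. -/
theorem exists_central (hJ : IsComplexStructure J) :
    ∃ u, (∀ i, gen i u = 0) ∧ ∃ i, gen i (J u) ≠ 0 := by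
  by_contra! h
  let A : Matrix (Fin 3) (Fin 3) ℝ := Matrix.of fun i j => cen i (J (basisE (.inr j)))
  have hJe : ∀ j, J (basisE (.inr j)) = ∑ k, A k j • basisE (.inr k) := fun j => by
    have hg := h (basisE (.inr j)) (fun i => gen_basisE_inr i j)
    conv_lhs => rw [eq_sum_coords (J (basisE (.inr j)))]
    simp [hg, A, Fin.sum_univ_three]
  have hA : A * A = -1 := by
    ext i j
    have h₁ := congrArg (cen i) (hJ.sq (basisE (.inr j)))
    rw [hJe] at h₁
    simp only [map_sum, map_smul, map_neg, cen_basisE_inr, smul_eq_mul] at h₁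
    rw [Matrix.mul_apply, Matrix.neg_apply, Matrix.one_apply]
    simp only [eq_comm (a := i)]
    rw [← h₁]
    exact Finset.sum_congr rfl fun k _ => mul_comm _ _
  -- A real 3 × 3 matrix with square `-1` would satisfy `(det A)² = (-1)³`.
  have hdet := congrArg Matrix.det hA
  rw [Matrix.det_mul, Matrix.det_neg, Matrix.det_one, Fintype.card_fin] at hdet
  nlinarith [mul_self_nonneg A.det]

/-- For central `u` two of the four Nijenhuis terms vanish; the other two say that `ad (J u)`
commutes with `J`. -/
theorem lie_map_of_central (hJ : IsComplexStructure J) {u : CotangentHeisenberg}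
    (hu : ∀ i, gen i u = 0) (x : CotangentHeisenberg) : ⁅J u, J x⁆ = J ⁅J u, x⁆ := by
  have h := hJ.nijenhuis u x
  rw [lie_eq_zero_of_gen_eq_zero hu, lie_eq_zero_of_gen_eq_zero hu, map_zero, add_zero,
    zero_sub, neg_add_eq_zero] at h
  exact h

/-- No nonzero vector is real proportional to its image under `J`. -/
theorem eq_zero_of_smul_map (hJ : IsComplexStructure J) {p : CotangentHeisenberg} {r s : ℝ}
    (h : r • J p = s • p) (hr : r ≠ 0) : p = 0 := by
  have h₁ := congrArg J h
  rw [map_smul, map_smul, hJ.sq] at h₁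
  have h₂ : (r * r + s * s) • p = 0 := by
    calc (r * r + s * s) • p = r • r • p + s • s • p := by module
      _ = r • r • p + r • s • J p := by rw [← h, smul_comm s r]
      _ = 0 := by rw [← h₁]; module
  refine (smul_eq_zero.1 h₂).resolve_left ?_
  have := mul_self_pos.2 hr
  nlinarith [mul_self_nonneg s]

/-- If the three vectors were dependent modulo the centre, the cross products `p = [J u, b]` and `[J
u, J b] = J p` would be parallel, which `J² = -1` forbids for `p ≠ 0`. -/
theorem vol_map_ne_zero (hJ : IsComplexStructure J) {u b : CotangentHeisenberg}
    (hu : ∀ i, gen i u = 0) (hb : ⁅J u, b⁆ ≠ 0) : vol (J u) b (J b) ≠ 0 := by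
  intro hv
  have hp := hJ.lie_map_of_central hu b
  -- The 2 × 2 minors of `p` and `J p` are, up to sign, the coordinates of `J u` times the volume,
  -- by `(a × b) × (a × c) = det(a, b, c) a`.
  have key : ∀ i, cen i ⁅J u, b⁆ • J ⁅J u, b⁆ = cen i ⁅J u, J b⁆ • ⁅J u, b⁆ := fun i => by
    rw [← hp]
    unfold vol at hv
    fin_cases i <;>
    · apply ext_coords <;>
      simp only [Fin.zero_eta, Fin.mk_one, Fin.reduceFinMk, map_smul, smul_eq_mul, gen_lie,
        cen_zero_lie, cen_one_lie, cen_two_lie] <;>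
      first
      | ring1
      | linear_combination gen 0 (J u) * hv
      | linear_combination gen 1 (J u) * hv
      | linear_combination gen 2 (J u) * hv
      | linear_combination -gen 0 (J u) * hv
      | linear_combination -gen 1 (J u) * hv
      | linear_combination -gen 2 (J u) * hv
  have hz : ∀ i, cen i ⁅J u, b⁆ = 0 := fun i => by
    by_contra hi
    exact hb (hJ.eq_zero_of_smul_map (key i) hi)
  exact hb (ext_coords (by simp) (by simp) (by simp) (by rw [hz, map_zero])
    (by rw [hz, map_zero]) (by rw [hz, map_zero]))

/-- Some vector `b` generates `T*𝔥₃` together with `J b` and `J [b, J b]`. -/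
theorem exists_generator (hJ : IsComplexStructure J) : ∃ b, vol b (J b) (J ⁅b, J b⁆) ≠ 0 := by
  obtain ⟨u, hu, hi⟩ := hJ.exists_central
  obtain ⟨b, hb⟩ := exists_lie_ne_zero hi
  have hv := hJ.vol_map_ne_zero hu hb
  have hp := hJ.lie_map_of_central hu b
  refine ⟨b, fun h => hv ?_⟩
  -- The brackets of `J u, b, J b` are their dual basis up to the volume, so the coefficients of `u`
  -- are scalar products with these vectors. The minus sign comes from writing `[J u, J b]` for `[J
  -- b, J u]`.
  obtain ⟨r, s, t, hr⟩ : ∃ r s t : ℝ, vol (J u) b (J b) • u =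
      r • ⁅b, J b⁆ + s • ⁅J u, J b⁆ + t • ⁅J u, b⁆ := by
    refine ⟨cen 0 u * gen 0 (J u) + cen 1 u * gen 1 (J u) + cen 2 u * gen 2 (J u),
      -(cen 0 u * gen 0 b + cen 1 u * gen 1 b + cen 2 u * gen 2 b),
      cen 0 u * gen 0 (J b) + cen 1 u * gen 1 (J b) + cen 2 u * gen 2 (J b), ?_⟩
    unfold vol
    apply ext_coords <;> simp only [map_add, map_smul, smul_eq_mul, gen_lie, cen_zero_lie,
      cen_one_lie, cen_two_lie, hu] <;> ring
  -- The last two brackets are `J p` and `p`, which `J` keeps in the centre. Hence `J u` is a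
  -- multiple of `J q` modulo the centre, and `J q` can take its place in the volume.
  have hJr := congrArg J hr
  rw [map_add, map_add, map_smul, map_smul, map_smul, map_smul, hp, hJ.sq, ← hp] at hJr
  have hg : ∀ i, vol (J u) b (J b) * gen i (J u) = r * gen i (J ⁅b, J b⁆) := fun i => by
    have := congrArg (gen i) hJr
    simpa using this
  refine mul_self_eq_zero.1 ?_
  calc vol (J u) b (J b) * vol (J u) b (J b) = r * vol b (J b) (J ⁅b, J b⁆) := by
        generalize hc : vol (J u) b (J b) = c at hg ⊢
        nth_rewrite 1 [← hc]
        unfold vol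
        linear_combination (gen 1 b * gen 2 (J b) - gen 2 b * gen 1 (J b)) * hg 0 +
          (gen 2 b * gen 0 (J b) - gen 0 b * gen 2 (J b)) * hg 1 +
          (gen 0 b * gen 1 (J b) - gen 1 b * gen 0 (J b)) * hg 2
    _ = 0 := by rw [h, mul_zero]

end IsComplexStructure

/-! ### Frames adapted to a complex structure -/

section Frame

variable (J : Module.End ℝ CotangentHeisenberg) (b : CotangentHeisenberg)

/-- Combinations of `b`, `J b`, `J q`, `p`, `J p`, `q` for `q = [b, J b]` and `p = [J q, b]`. -/
noncomputable def frame (x₀ x₁ x₂ x₃ x₄ x₅ : ℝ) : CotangentHeisenberg :=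
  x₀ • b + x₁ • J b + x₂ • J ⁅b, J b⁆ + x₃ • ⁅J ⁅b, J b⁆, b⁆ + x₄ • J ⁅J ⁅b, J b⁆, b⁆ +
    x₅ • ⁅b, J b⁆

variable {J b}

theorem map_frame (hJ : IsComplexStructure J) (x₀ x₁ x₂ x₃ x₄ x₅ : ℝ) :
    J (frame J b x₀ x₁ x₂ x₃ x₄ x₅) = frame J b (-x₁) x₀ x₅ (-x₄) x₃ (-x₂) := by
  simp only [frame, map_add, map_smul, hJ.sq]
  module

/-- The only brackets among the frame vectors are `[b, J b] = q`, `[J q, b] = p` and, since `ad (J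
q)` commutes with `J`, `[J q, J b] = J p`. With `map_frame` this describes all complex structures at
once. -/
theorem lie_frame (hJ : IsComplexStructure J) (x₀ x₁ x₂ x₃ x₄ x₅ y₀ y₁ y₂ y₃ y₄ y₅ : ℝ) :
    ⁅frame J b x₀ x₁ x₂ x₃ x₄ x₅, frame J b y₀ y₁ y₂ y₃ y₄ y₅⁆ =
      frame J b 0 0 0 (x₂ * y₀ - x₀ * y₂) (x₂ * y₁ - x₁ * y₂) (x₀ * y₁ - x₁ * y₀) := by
  have h := hJ.lie_map_of_central (u := ⁅b, J b⁆) (fun i => gen_lie i _ _) b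
  simp only [frame, ← h]
  apply ext_coords <;> simp only [map_add, map_smul, smul_eq_mul, gen_lie, cen_zero_lie,
    cen_one_lie, cen_two_lie] <;> ring

theorem gen_frame (hJ : IsComplexStructure J) (i : Fin 3) (x₀ x₁ x₂ x₃ x₄ x₅ : ℝ) :
    gen i (frame J b x₀ x₁ x₂ x₃ x₄ x₅) =
      x₀ * gen i b + x₁ * gen i (J b) + x₂ * gen i (J ⁅b, J b⁆) := by
  have h := hJ.lie_map_of_central (u := ⁅b, J b⁆) (fun i => gen_lie i _ _) b
  simp [frame, ← h]

/-- The automorphism that sends `e₁, …, e₆` to `b, J b, J q, -J p, p, q`. -/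
theorem exists_lieEquiv_frame (hJ : IsComplexStructure J) (hb : vol b (J b) (J ⁅b, J b⁆) ≠ 0) :
    ∃ F : CotangentHeisenberg ≃ₗ⁅ℝ⁆ CotangentHeisenberg, ∀ y,
      F y = frame J b (gen 0 y) (gen 1 y) (gen 2 y) (cen 1 y) (-cen 0 y) (cen 2 y) := by
  obtain ⟨F, hF⟩ := exists_lieEquiv_of_vol_ne_zero _ _ _ hb
  refine ⟨F, fun y => ?_⟩
  rw [hF, frame, ← hJ.lie_map_of_central (u := ⁅b, J b⁆) (fun i => gen_lie i _ _) b,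
    ← lie_skew (J ⁅b, J b⁆) (J b)]
  module

theorem frame_central_eq_zero (hJ : IsComplexStructure J)
    (hb : vol b (J b) (J ⁅b, J b⁆) ≠ 0) {x₃ x₄ x₅ : ℝ} (h : frame J b 0 0 0 x₃ x₄ x₅ = 0) :
    x₃ = 0 ∧ x₅ = 0 := by
  obtain ⟨F, hF⟩ := exists_lieEquiv_frame hJ hb
  have h₀ : F (ofCoords 0 0 0 (-x₄) x₃ x₅) = 0 := by
    rw [hF, ← h]
    simp
  have h₁ : ofCoords 0 0 0 (-x₄) x₃ x₅ = 0 := F.injective (h₀.trans (map_zero F).symm)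
  exact ⟨by simpa using congrArg (cen 1) h₁, by simpa using congrArg (cen 2) h₁⟩

end Frame

/-! ### Pseudo-Kähler structures on `T*𝔥₃` -/

namespace IsPseudoKahlerStructure

variable {J : Module.End ℝ CotangentHeisenberg} {Ω : LinearMap.BilinForm ℝ CotangentHeisenberg}

/-- With a central third argument only one term of the closedness identity survives. Since brackets
span the centre, the centre is isotropic. -/
theorem form_lie_central (h : IsPseudoKahlerStructure J Ω) (x y : CotangentHeisenberg)
    {z : CotangentHeisenberg} (hz : ∀ i, gen i z = 0) : Ω ⁅x, y⁆ z = 0 := by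
  have hc := h.symplectic.closed x y z
  rw [← lie_skew y z, lie_eq_zero_of_gen_eq_zero hz, lie_eq_zero_of_gen_eq_zero hz] at hc
  simpa using hc

/-- A compatible symplectic form in an adapted frame. -/
theorem form_frame (h : IsPseudoKahlerStructure J Ω) (b : CotangentHeisenberg)
    (x₀ x₁ x₂ x₃ x₄ x₅ y₀ y₁ y₂ y₃ y₄ y₅ : ℝ) :
    Ω (frame J b x₀ x₁ x₂ x₃ x₄ x₅) (frame J b y₀ y₁ y₂ y₃ y₄ y₅) =
      Ω b (J b) * (x₀ * y₁ - x₁ * y₀) +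
      Ω b ⁅b, J b⁆ * (x₀ * y₅ - x₅ * y₀ + x₁ * y₂ - x₂ * y₁) +
      Ω (J b) ⁅b, J b⁆ * (x₁ * y₅ - x₅ * y₁ - x₀ * y₂ + x₂ * y₀) +
      Ω b ⁅J ⁅b, J b⁆, b⁆ * (x₀ * y₃ - x₃ * y₀ + x₁ * y₄ - x₄ * y₁) +
      Ω (J b) ⁅J ⁅b, J b⁆, b⁆ * (x₁ * y₃ - x₃ * y₁ - x₀ * y₄ + x₄ * y₀ -
        2 * (x₂ * y₅ - x₅ * y₂)) := by
  have hJp := h.complex.lie_map_of_central (u := ⁅b, J b⁆) (fun i => gen_lie i _ _) b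
  -- The closedness relation that remains, on the generators `J q, b, J b`; it becomes `Ω(J q, q) =
  -- -2 Ω(J b, p)` in `e₁`.
  have hcl := h.symplectic.closed (J ⁅b, J b⁆) b (J b)
  rw [← lie_skew (J b), hJp] at hcl
  have hpq : Ω ⁅J ⁅b, J b⁆, b⁆ ⁅b, J b⁆ = 0 := h.form_lie_central _ _ fun i => gen_lie i _ _
  have hrq : Ω (J ⁅J ⁅b, J b⁆, b⁆) ⁅b, J b⁆ = 0 := by
    rw [← hJp]; exact h.form_lie_central _ _ fun i => gen_lie i _ _
  have hrp : Ω (J ⁅J ⁅b, J b⁆, b⁆) ⁅J ⁅b, J b⁆, b⁆ = 0 := by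
    rw [← hJp]; exact h.form_lie_central _ _ fun i => gen_lie i _ _
  unfold frame
  generalize ⁅J ⁅b, J b⁆, b⁆ = p at *
  generalize ⁅b, J b⁆ = q at *
  have skew : ∀ x y, Ω x y = -Ω y x := fun x y => (h.symplectic.alt.neg_eq y x).symm
  have self : ∀ x, Ω x x = 0 := h.symplectic.alt
  have hmap : ∀ x y, Ω x (J y) = -Ω (J x) y := fun x y => by
    rw [← h.compatible x (J y), h.complex.sq, map_neg]
  have hcompat := h.compatible
  have symm : ∀ x y, Ω (J x) y = Ω (J y) x := fun x y => by rw [skew, hmap, neg_neg]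
  have e₁ : Ω (J q) q = -2 * Ω (J b) p := by
    simp only [map_neg, LinearMap.neg_apply, hmap p b, skew q, symm p b] at hcl
    linear_combination -hcl
  simp only [map_add, map_smul, LinearMap.add_apply, LinearMap.smul_apply, smul_eq_mul, hcompat,
    self, hmap, hpq, hrq, hrp, e₁, skew q b, skew p b, skew q p, symm q b, symm p b, symm q p]
  ring

end IsPseudoKahlerStructure

/-! ### Normalization of a pseudo-Kähler structure on `T*𝔥₃` -/

/-- Modulo the centre the new triple is triangular in the old one, with diagonal `s, s, s²`. So
every such change of `b` again gives an adapted frame. -/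
theorem vol_frame_ne_zero {J : Module.End ℝ CotangentHeisenberg} (hJ : IsComplexStructure J)
    {b : CotangentHeisenberg} (hb : vol b (J b) (J ⁅b, J b⁆) ≠ 0) {s : ℝ} (hs : s ≠ 0)
    (x₂ x₃ x₄ x₅ : ℝ) :
    vol (frame J b s 0 x₂ x₃ x₄ x₅) (J (frame J b s 0 x₂ x₃ x₄ x₅))
      (J ⁅frame J b s 0 x₂ x₃ x₄ x₅, J (frame J b s 0 x₂ x₃ x₄ x₅)⁆) ≠ 0 := by
  have h : vol (frame J b s 0 x₂ x₃ x₄ x₅) (J (frame J b s 0 x₂ x₃ x₄ x₅))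
      (J ⁅frame J b s 0 x₂ x₃ x₄ x₅, J (frame J b s 0 x₂ x₃ x₄ x₅)⁆) =
      s ^ 4 * vol b (J b) (J ⁅b, J b⁆) := by
    simp only [map_frame hJ, lie_frame hJ, vol, gen_frame hJ]
    ring
  rw [h]
  exact mul_ne_zero (pow_ne_zero 4 hs) hb

namespace IsPseudoKahlerStructure

variable {J : Module.End ℝ CotangentHeisenberg} {Ω : LinearMap.BilinForm ℝ CotangentHeisenberg}
  {b : CotangentHeisenberg}

theorem eq_zero_of_form_frame_eq_zero (h : IsPseudoKahlerStructure J Ω)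
    (hb : vol b (J b) (J ⁅b, J b⁆) ≠ 0) {x₃ x₄ x₅ : ℝ}
    (hx : ∀ y₀ y₁ y₂ y₃ y₄ y₅,
      Ω (frame J b 0 0 0 x₃ x₄ x₅) (frame J b y₀ y₁ y₂ y₃ y₄ y₅) = 0) : x₃ = 0 ∧ x₅ = 0 := by
  refine frame_central_eq_zero h.complex hb (x₄ := x₄) (h.symplectic.nondegenerate.1 _ fun y => ?_)
  obtain ⟨F, hF⟩ := exists_lieEquiv_frame h.complex hb
  obtain ⟨z, rfl⟩ := F.surjective y
  change Ω _ (F z) = 0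
  rw [hF]
  exact hx _ _ _ _ _ _

/-- If `P = 0`, the centre is isotropic and orthogonal to `J q`, hence pairs only with `b` and `J
b`; being 3-dimensional, it then meets the radical of `Ω`. -/
theorem form_pairing_ne_zero (h : IsPseudoKahlerStructure J Ω)
    (hb : vol b (J b) (J ⁅b, J b⁆) ≠ 0) : Ω (J b) ⁅J ⁅b, J b⁆, b⁆ ≠ 0 := by
  intro hP
  by_cases hQ : Ω b ⁅J ⁅b, J b⁆, b⁆ = 0
  · refine one_ne_zero (h.eq_zero_of_form_frame_eq_zero hb (x₃ := 1) (x₄ := 0) (x₅ := 0)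
      fun y₀ y₁ y₂ y₃ y₄ y₅ => ?_).1
    rw [h.form_frame, hP, hQ]
    ring
  -- The radical vector is `q - (S/Q) p - (T/Q) J p`.
  · refine one_ne_zero (h.eq_zero_of_form_frame_eq_zero hb
      (x₃ := -Ω b ⁅b, J b⁆ / Ω b ⁅J ⁅b, J b⁆, b⁆)
      (x₄ := -Ω (J b) ⁅b, J b⁆ / Ω b ⁅J ⁅b, J b⁆, b⁆) (x₅ := 1)
      fun y₀ y₁ y₂ y₃ y₄ y₅ => ?_).2
    rw [h.form_frame, hP]
    field_simp
    ring

/-- A generator that is orthogonal to `q = [b, J b]` and `J q`. -/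
theorem exists_orthogonal_generator (h : IsPseudoKahlerStructure J Ω) :
    ∃ b, vol b (J b) (J ⁅b, J b⁆) ≠ 0 ∧ Ω b ⁅b, J b⁆ = 0 ∧ Ω (J b) ⁅b, J b⁆ = 0 := by
  obtain ⟨b, hb⟩ := h.complex.exists_generator
  have hP := h.form_pairing_ne_zero hb
  generalize hP' : Ω (J b) ⁅J ⁅b, J b⁆, b⁆ = P at hP
  generalize hQ' : Ω b ⁅J ⁅b, J b⁆, b⁆ = Q
  generalize hS' : Ω b ⁅b, J b⁆ = S
  generalize hT' : Ω (J b) ⁅b, J b⁆ = T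
  have hD : 9 * P ^ 2 + Q ^ 2 ≠ 0 := by positivity
  -- For `b + c J q + d q` the new bracket is `q - d p + c J p`, and these are the new values of `S`
  -- and `T`. The system has determinant `9 P² + Q²`.
  obtain ⟨c, d, h₁, h₂⟩ : ∃ c d : ℝ, S - 3 * P * c - Q * d = 0 ∧ T - 3 * P * d + Q * c = 0 := by
    refine ⟨(3 * P * S - Q * T) / (9 * P ^ 2 + Q ^ 2),
      (3 * P * T + Q * S) / (9 * P ^ 2 + Q ^ 2), ?_, ?_⟩ <;> field_simp <;> ring
  refine ⟨frame J b 1 0 c 0 0 d, vol_frame_ne_zero h.complex hb one_ne_zero _ _ _ _, ?_, ?_⟩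
  · simp only [map_frame h.complex, lie_frame h.complex, h.form_frame, hP', hQ', hS', hT']
    linear_combination h₁
  · simp only [map_frame h.complex, lie_frame h.complex, h.form_frame, hP', hQ', hS', hT']
    linear_combination h₂

/-- A generator that is moreover isotropic. -/
theorem exists_isotropic_generator (h : IsPseudoKahlerStructure J Ω) :
    ∃ b, vol b (J b) (J ⁅b, J b⁆) ≠ 0 ∧ Ω b ⁅b, J b⁆ = 0 ∧ Ω (J b) ⁅b, J b⁆ = 0 ∧
      Ω b (J b) = 0 := by
  obtain ⟨b, hb, hS, hT⟩ := h.exists_orthogonal_generator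
  have hP := h.form_pairing_ne_zero hb
  -- Adding `t p` changes `N` to `N - 2 P t` and, `p` being central, leaves `q` unchanged.
  refine ⟨frame J b 1 0 0 (Ω b (J b) / (2 * Ω (J b) ⁅J ⁅b, J b⁆, b⁆)) 0 0,
    vol_frame_ne_zero h.complex hb one_ne_zero _ _ _ _, ?_, ?_, ?_⟩
  · simp only [map_frame h.complex, lie_frame h.complex, h.form_frame, hS, hT]
    ring
  · simp only [map_frame h.complex, lie_frame h.complex, h.form_frame, hS, hT]
    ring
  · simp only [map_frame h.complex, h.form_frame, hS, hT]
    field_simp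
    ring

/-- Scaling `b` by `s` scales `q` by `s²` and `p` by `s³`, hence `P` by `s⁴`: its size can be
normalized, but not its sign. -/
theorem exists_normalized_generator (h : IsPseudoKahlerStructure J Ω) :
    ∃ b, vol b (J b) (J ⁅b, J b⁆) ≠ 0 ∧ Ω b ⁅b, J b⁆ = 0 ∧ Ω (J b) ⁅b, J b⁆ = 0 ∧
      Ω b (J b) = 0 ∧ |2 * Ω (J b) ⁅J ⁅b, J b⁆, b⁆| = 1 := by
  obtain ⟨b, hb, hS, hT, hN⟩ := h.exists_isotropic_generator
  have hP := h.form_pairing_ne_zero hb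
  have hpos : 0 < |2 * Ω (J b) ⁅J ⁅b, J b⁆, b⁆| := abs_pos.2 (mul_ne_zero two_ne_zero hP)
  obtain ⟨s, hs, hs'⟩ : ∃ s : ℝ, s ≠ 0 ∧ s ^ 4 * |2 * Ω (J b) ⁅J ⁅b, J b⁆, b⁆| = 1 := by
    refine ⟨√√(|2 * Ω (J b) ⁅J ⁅b, J b⁆, b⁆|)⁻¹, by positivity, ?_⟩
    rw [show 4 = 2 * 2 from rfl, pow_mul, Real.sq_sqrt (Real.sqrt_nonneg _),
      Real.sq_sqrt (by positivity), inv_mul_cancel₀ hpos.ne']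
  refine ⟨frame J b s 0 0 0 0 0, vol_frame_ne_zero h.complex hb hs _ _ _ _, ?_, ?_, ?_, ?_⟩
  · simp only [map_frame h.complex, lie_frame h.complex, h.form_frame, hS, hT]
    ring
  · simp only [map_frame h.complex, lie_frame h.complex, h.form_frame, hS, hT]
    ring
  · simp only [map_frame h.complex, h.form_frame, hN]
    ring
  · simp only [map_frame h.complex, lie_frame h.complex, h.form_frame]
    rw [← hs', ← abs_of_nonneg (show 0 ≤ s ^ 4 by positivity), ← abs_mul]
    congr 1
    ring

end IsPseudoKahlerStructure

theorem blockMetric_normalForm_apply (ε m₁₁ m₁₂ : ℝ) (x y : CotangentHeisenberg) :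
    blockMetric (ε • E10) (rotM m₁₁ m₁₂) (ε • E10) x y =
      ε * (gen 2 x * gen 2 y + cen 2 x * cen 2 y) +
      m₁₁ * (gen 0 x * cen 0 y + cen 0 x * gen 0 y + gen 1 x * cen 1 y + cen 1 x * gen 1 y) +
      m₁₂ * (gen 0 x * cen 1 y + cen 1 x * gen 0 y - gen 1 x * cen 0 y - cen 0 x * gen 1 y) := by
  rw [blockMetric, Matrix.toBilin_apply]
  simp only [Fintype.sum_sum_type, Fin.sum_univ_three, Matrix.fromBlocks_apply₁₁,
    Matrix.fromBlocks_apply₁₂, Matrix.fromBlocks_apply₂₁, Matrix.fromBlocks_apply₂₂,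
    Matrix.transpose_apply, Matrix.smul_apply, E10, rotM]
  simp [gen, cen]
  ring

/-- The parameters are `ε = -2P`, `m₁₁ = -Q` and `m₁₂ = P`, so the normalization in fact achieves
`m₁₂ = -ε/2`. -/
theorem IsPseudoKahlerMetric.exists_areEquivalent_blockMetric
    {g : LinearMap.BilinForm ℝ CotangentHeisenberg} (hg : IsPseudoKahlerMetric g) :
    ∃ ε m₁₁ m₁₂ : ℝ, (ε = 1 ∨ ε = -1) ∧ m₁₂ ≠ 0 ∧
      AreEquivalent g (blockMetric (ε • E10) (rotM m₁₁ m₁₂) (ε • E10)) := by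
  obtain ⟨J, Ω, h, hgΩ⟩ := hg
  obtain ⟨b, hb, hS, hT, hN, hP⟩ := h.exists_normalized_generator
  obtain ⟨F, hF⟩ := exists_lieEquiv_frame h.complex hb
  refine ⟨-(2 * Ω (J b) ⁅J ⁅b, J b⁆, b⁆), -Ω b ⁅J ⁅b, J b⁆, b⁆, Ω (J b) ⁅J ⁅b, J b⁆, b⁆, ?_,
    h.form_pairing_ne_zero hb, F, fun x y => ?_⟩
  · rwa [← abs_eq zero_le_one, abs_neg]
  · rw [hgΩ, hF, hF, map_frame h.complex, h.form_frame, hS, hT, hN, blockMetric_normalForm_apply]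
    ring

end PseudoKahlerCotangent

theorem proposition4p10 :
    (∃ g : LinearMap.BilinForm ℝ CotangentHeisenberg,
      IsPseudoKahlerMetric g ∧ IsRicciFlat g ∧ ¬ IsFlat g) ∧
    (∀ g : LinearMap.BilinForm ℝ CotangentHeisenberg, IsPseudoKahlerMetric g →
      ∃ ε m₁₁ m₁₂ : ℝ, (ε = 1 ∨ ε = -1) ∧ m₁₂ ≠ 0 ∧
        AreEquivalent g (blockMetric (ε • E10) (rotM m₁₁ m₁₂) (ε • E10))) := by
  exact ⟨⟨modelMetric, isPseudoKahlerMetric_model, isRicciFlat_model, not_isFlat_model⟩,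
    fun _ hg => hg.exists_areEquivalent_blockMetric⟩
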